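/- Let $\Delta<0$ be a fundamental discriminant, and let $\mathrm{Cl}(\Delta)$ be the group of proper ($\mathrm{SL}_2(\mathbb Z)$-)equivalence classes of positive definite integral binary quadratic forms $(A,B,C)=AX^2+BXY+CY^2$ with discriminant $B^2-4AC=\Delta$, under Dirichlet composition: $(a_1,b,a_2c)\cdot(a_2,b,a_1c)=(a_1a_2,b,c)$ whenever $\gcd(a_1,a_2,b)=1$. Its neutral element is the class of the principal form $Q_0=(1,\sigma,(\sigma^2-\Delta)/4)$, where $\sigma\in\{0,1\}$ and $\sigma\equiv\Delta \bmod 2$. Let $Q$ be such a form and let $a=Q(x,y)$ with $\gcd(x,y)=1$. There is a unique form $(a,B,C)$ with $-a<B\le a$ to which $Q$ is carried by a matrix in $\mathrm{SL}_2(\mathbb Z)$ with first column $(x,y)^{T}$. Write $a=\prod_j p_j^{a_j}$ with distinct primes $p_j$; for each $j$ let $b_j$ be the integer with $-p_j<b_j\le p_j$ and $b_j\equiv B \bmod 2p_j$, and put $s_j=+1$ if $b_j\ge 0$ and $s_j=-1$ if $b_j<0$. The value of the Šimerka map at this primitive representation is $$\check{s}(Q,a)=\prod_j p_j^{s_ja_j}\in\mathbb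 Q^\times .$$ Let $\mathcal R\subseteq\mathbb Q^\times$ be the subgroup generated by the values $\check{s}(Q_0,a)$ at all primitive representations of integers $a$ by the principal form $Q_0$. Then there is a group homomorphism $\check{s}:\mathrm{Cl}(\Delta)\to\mathbb Q^\times/\mathcal R$ which sends the class of every form $Q$ to $\check{s}(Q,a)\bmod\mathcal R$, for every primitive representation of an integer $a$ by $Q$ (in particular, this residue class depends neither on the representation nor on the form chosen in the class), and this homomorphism is injective. -/

import Mathlib

/-- Fundamental discriminants: either `Δ ≡ 1 mod 4` is squarefree and different from `1`, or
`Δ = 4 m` with `m` squarefree and `m ≡ 2, 3 mod 4`. -/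
def IsFundamentalDiscriminant (Δ : ℤ) : Prop :=
  (Δ ≠ 1 ∧ Δ % 4 = 1 ∧ Squarefree Δ) ∨
    ∃ m : ℤ, Δ = 4 * m ∧ Squarefree m ∧ (m % 4 = 2 ∨ m % 4 = 3)

/-- A binary quadratic form `(a, b, c) = a X² + b X Y + c Y²` with integral coefficients,
discriminant `b² - 4ac = Δ` and positive leading coefficient. For `Δ < 0` these are exactly the
positive definite forms with discriminant `Δ`. -/
@[ext] structure PosForm (Δ : ℤ) where
  a : ℤ
  b : ℤ
  c : ℤ
  a_pos : 0 < a
  disc_eq : b ^ 2 - 4 * a * c = Δ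

namespace PosForm

variable {Δ : ℤ}

/-- The value `Q(x, y)`. -/
def eval (Q : PosForm Δ) (x y : ℤ) : ℤ := Q.a * x ^ 2 + Q.b * x * y + Q.c * y ^ 2

/-- `Q.IsTransform x u y v F` says that the matrix with rows `(x, u)` and `(y, v)` has
determinant `1` and carries `Q` to `F`. -/
def IsTransform (Q : PosForm Δ) (x u y v : ℤ) (F : PosForm Δ) : Prop :=
  x * v - u * y = 1 ∧ ∀ X Y : ℤ, F.eval X Y = Q.eval (x * X + u * Y) (y * X + v * Y)

/-- Proper equivalence of forms (with respect to `SL₂(ℤ)`). -/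
def Equivalent (Q F : PosForm Δ) : Prop := ∃ x u y v : ℤ, Q.IsTransform x u y v F

theorem Equivalent.refl (Q : PosForm Δ) : Q.Equivalent Q :=
  ⟨1, 0, 0, 1, by norm_num, fun X Y => by congr 1 <;> ring⟩

theorem Equivalent.symm {Q F : PosForm Δ} (h : Q.Equivalent F) : F.Equivalent Q := by
  obtain ⟨x, u, y, v, hd, h⟩ := h
  refine ⟨v, -u, -y, x, by linarith, fun X Y => ?_⟩
  rw [h]
  congr 1
  · linear_combination (-X) * hd
  · linear_combination (-Y) * hd

theorem Equivalent.trans {Q F G : PosForm Δ} (h : Q.Equivalent F) (h' : F.Equivalent G) :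
    Q.Equivalent G := by
  obtain ⟨x, u, y, v, hd, h⟩ := h
  obtain ⟨x', u', y', v', hd', h'⟩ := h'
  refine ⟨x * x' + u * y', x * u' + u * v', y * x' + v * y', y * u' + v * v', ?_, fun X Y => ?_⟩
  · linear_combination (x' * v' - u' * y') * hd + hd'
  · rw [h', h]
    congr 1 <;> ring

instance setoid (Δ : ℤ) : Setoid (PosForm Δ) where
  r := Equivalent
  iseqv := ⟨Equivalent.refl, Equivalent.symm, Equivalent.trans⟩

theorem IsTransform.coeffs {Q F : PosForm Δ} {x u y v : ℤ} (h : Q.IsTransform x u y v F) :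
    F.a = Q.eval x y ∧ F.b = 2 * Q.a * x * u + Q.b * (x * v + u * y) + 2 * Q.c * y * v ∧
      F.c = Q.eval u v := by
  have h1 := h.2 1 0
  have h2 := h.2 0 1
  have h3 := h.2 1 1
  simp only [eval] at *
  refine ⟨by linarith, by linarith, by linarith⟩

theorem c_pos (hΔ : Δ < 0) (Q : PosForm Δ) : 0 < Q.c := by
  have h := Q.disc_eq
  have := Q.a_pos
  by_contra hc
  nlinarith [sq_nonneg Q.b]

theorem eval_pos (hΔ : Δ < 0) (Q : PosForm Δ) {x y : ℤ} (h : x ≠ 0 ∨ y ≠ 0) :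
    0 < Q.eval x y := by
  have h1 : 4 * Q.a * Q.eval x y = (2 * Q.a * x + Q.b * y) ^ 2 + (-Δ) * y ^ 2 := by
    have := Q.disc_eq
    rw [eval]; linear_combination (-y ^ 2) * this
  have ha := Q.a_pos
  have hp : 0 < 4 * Q.a * Q.eval x y := by
    rw [h1]
    by_cases hy : y = 0
    · subst hy
      have hx : x ≠ 0 := by tauto
      have : 0 < (2 * Q.a * x + Q.b * 0) ^ 2 := by
        have : 2 * Q.a * x + Q.b * 0 ≠ 0 := by simp [hx, ha.ne']
        positivity
      linarith
    · have : 0 < (-Δ) * y ^ 2 := by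
        have : 0 < -Δ := by linarith
        positivity
      nlinarith [sq_nonneg (2 * Q.a * x + Q.b * y)]
  exact pos_of_mul_pos_right hp (by linarith)

theorem exists_transform (hΔ : Δ < 0) (Q : PosForm Δ) {x u y v : ℤ} (h : x * v - u * y = 1) :
    ∃ F : PosForm Δ, Q.IsTransform x u y v F := by
  refine ⟨⟨Q.eval x y, 2 * Q.a * x * u + Q.b * (x * v + u * y) + 2 * Q.c * y * v, Q.eval u v,
    Q.eval_pos hΔ ?_, ?_⟩, h, fun X Y => ?_⟩
  · by_contra hc
    push Not at hc
    simp [hc.1, hc.2] at h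
  · simp only [eval]
    have := Q.disc_eq
    linear_combination (x * v - u * y) ^ 2 * this + Δ * (x * v - u * y + 1) * h
  · simp only [eval]; ring

/-- The form obtained by the substitution `X ↦ X + k Y`. -/
theorem exists_shift (hΔ : Δ < 0) (Q : PosForm Δ) (k : ℤ) :
    ∃ F : PosForm Δ, Q.Equivalent F ∧ F.a = Q.a ∧ F.b = Q.b + 2 * Q.a * k := by
  obtain ⟨F, hF⟩ := Q.exists_transform hΔ (x := 1) (u := k) (y := 0) (v := 1) (by ring)
  obtain ⟨h1, h2, -⟩ := hF.coeffs
  exact ⟨F, ⟨_, _, _, _, hF⟩, by simp [h1, eval], by rw [h2]; ring⟩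

end PosForm

section Facts

variable {Δ : ℤ}

theorem IsFundamentalDiscriminant.mod_four (h : IsFundamentalDiscriminant Δ) :
    Δ % 4 = 0 ∨ Δ % 4 = 1 := by
  rcases h with h | ⟨m, rfl, -⟩
  · exact Or.inr h.2.1
  · left; simp

theorem PosForm.primitive (h : IsFundamentalDiscriminant Δ) (Q : PosForm Δ) (p : ℕ)
    (hp : p.Prime) (ha : (p : ℤ) ∣ Q.a) (hb : (p : ℤ) ∣ Q.b) (hc : (p : ℤ) ∣ Q.c) : False := by
  obtain ⟨a, ha⟩ := ha
  obtain ⟨b, hb⟩ := hb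
  obtain ⟨c, hc⟩ := hc
  have hd := Q.disc_eq
  rw [ha, hb, hc] at hd
  have hd' : Δ = p * p * (b ^ 2 - 4 * a * c) := by rw [← hd]; ring
  have hu : ¬ IsUnit (p : ℤ) := (Nat.prime_iff_prime_int.mp hp).not_isUnit
  rcases h with ⟨-, -, h⟩ | ⟨m, hm, h, hm'⟩
  · exact hu (h p ⟨_, hd'⟩)
  · rcases hp.eq_two_or_odd' with rfl | hodd
    · have h1 : m = b ^ 2 - 4 * a * c := by push_cast at hd'; linarith
      have h2 : b ^ 2 % 4 = 0 ∨ b ^ 2 % 4 = 1 := by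
        rcases Int.even_or_odd' b with ⟨k, rfl | rfl⟩
        · left; ring_nf; omega
        · right; ring_nf; omega
      have h3 : 4 * a * c = 4 * (a * c) := by ring
      rw [h3] at h1
      omega
    · have hco : IsCoprime ((p : ℤ) * p) 4 := by
        have : IsCoprime (p : ℤ) 2 := by
          have := (Nat.coprime_two_right).mpr hodd
          exact_mod_cast (Nat.isCoprime_iff_coprime.mpr this)
        have h4 : IsCoprime (p : ℤ) 4 := by
          have := this.pow_right (n := 2)
          norm_num at this
          exact this
        exact h4.mul_left h4
      have : (p : ℤ) * p ∣ 4 * m := ⟨_, by rw [← hm, hd']⟩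
      exact hu (h p (hco.dvd_of_dvd_mul_left this))

end Facts

/-- The principal form `(1, σ, (σ² - Δ)/4)` with discriminant `Δ`, where `σ ∈ {0, 1}` has the
parity of `Δ`. -/
def principalForm (Δ : ℤ) [hf : Fact (IsFundamentalDiscriminant Δ)] : PosForm Δ where
  a := 1
  b := Δ % 2
  c := ((Δ % 2) ^ 2 - Δ) / 4
  a_pos := one_pos
  disc_eq := by
    have h := hf.out.mod_four
    rcases h with h | h
    · have : Δ % 2 = 0 := by omega
      rw [this]; omega
    · have : Δ % 2 = 1 := by omega
      rw [this]; omega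

/-- Dirichlet composition: `F₁ = (a₁, b, a₂ c)` and `F₂ = (a₂, b, a₁ c)` with
`gcd (a₁, a₂, b) = 1` have the composite `F₃ = (a₁ a₂, b, c)`. -/
def IsDirichletComposite {Δ : ℤ} (F₁ F₂ F₃ : PosForm Δ) : Prop :=
  Int.gcd (Int.gcd F₁.a F₂.a) F₃.b = 1 ∧ F₁.b = F₃.b ∧ F₂.b = F₃.b ∧
    F₁.c = F₂.a * F₃.c ∧ F₂.c = F₁.a * F₃.c ∧ F₃.a = F₁.a * F₂.a

/-- The set `Cl(Δ)` of proper equivalence classes of positive definite forms with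
discriminant `Δ`. -/
def FormClassGroup (Δ : ℤ) : Type := Quotient (PosForm.setoid Δ)

/-- The class `[Q]` of a form. -/
def PosForm.toClass {Δ : ℤ} (Q : PosForm Δ) : FormClassGroup Δ := Quotient.mk _ Q

theorem PosForm.toClass_eq {Δ : ℤ} {Q F : PosForm Δ} :
    Q.toClass = F.toClass ↔ Q.Equivalent F := Quotient.eq

theorem FormClassGroup.exists_rep {Δ : ℤ} (X : FormClassGroup Δ) :
    ∃ Q : PosForm Δ, Q.toClass = X := Quotient.exists_rep X

/-! ### Composition of classes is well defined

Auxiliary facts: every pair of classes can be composed, and the class of the composite is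
determined by the lattices `ℤ a + ℤ (b + √Δ)/2` up to homothety. -/

namespace PosForm

variable {Δ : ℤ}

/-- Auxiliary: the lattice of a form has basis `a`, `τ = (b + √Δ)/2`. -/
noncomputable def tau (Q : PosForm Δ) : ℂ := ⟨(Q.b : ℝ) / 2, Real.sqrt (-Δ) / 2⟩

/-- Auxiliary: the lattice `ℤ a + ℤ τ`. -/
noncomputable def lattice (Q : PosForm Δ) : Submodule ℤ ℂ :=
  Submodule.span ℤ {(Q.a : ℂ), Q.tau}

/-- Auxiliary: homothety of lattices. -/
def Homothetic (L M : Submodule ℤ ℂ) : Prop := ∃ z : ℂ, z ≠ 0 ∧ M = Submodule.span ℤ {z} * L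

theorem span_one : Submodule.span ℤ {(1 : ℂ)} = 1 := Submodule.one_eq_span.symm

theorem Homothetic.refl (L : Submodule ℤ ℂ) : Homothetic L L :=
  ⟨1, one_ne_zero, by rw [span_one, one_mul]⟩

theorem Homothetic.symm {L M : Submodule ℤ ℂ} (h : Homothetic L M) : Homothetic M L := by
  obtain ⟨z, hz, rfl⟩ := h
  refine ⟨z⁻¹, inv_ne_zero hz, ?_⟩
  rw [← mul_assoc, Submodule.span_mul_span, Set.singleton_mul_singleton, inv_mul_cancel₀ hz,
    span_one, one_mul]

theorem Homothetic.trans {L M N : Submodule ℤ ℂ} (h : Homothetic L M) (h' : Homothetic M N) :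
    Homothetic L N := by
  obtain ⟨z, hz, rfl⟩ := h
  obtain ⟨w, hw, rfl⟩ := h'
  refine ⟨w * z, mul_ne_zero hw hz, ?_⟩
  rw [← mul_assoc, Submodule.span_mul_span, Set.singleton_mul_singleton]

theorem Homothetic.mul {L M L' M' : Submodule ℤ ℂ} (h : Homothetic L M)
    (h' : Homothetic L' M') : Homothetic (L * L') (M * M') := by
  obtain ⟨z, hz, rfl⟩ := h
  obtain ⟨w, hw, rfl⟩ := h'
  refine ⟨z * w, mul_ne_zero hz hw, ?_⟩
  rw [mul_mul_mul_comm, Submodule.span_mul_span, Set.singleton_mul_singleton]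

theorem span_mul_pair (z x y : ℂ) :
    Submodule.span ℤ {z} * Submodule.span ℤ {x, y} = Submodule.span ℤ {z * x, z * y} := by
  rw [Submodule.span_mul_span, Set.singleton_mul, Set.image_pair]

theorem tau_sq (hΔ : Δ < 0) (Q : PosForm Δ) : Q.tau ^ 2 = Q.b * Q.tau - Q.a * Q.c := by
  have hs : Real.sqrt (-Δ) ^ 2 = -(Δ : ℝ) := Real.sq_sqrt (by
    have : (Δ : ℝ) < 0 := by exact_mod_cast hΔ
    linarith)
  have hd : (Q.b : ℝ) ^ 2 - 4 * Q.a * Q.c = Δ := by exact_mod_cast Q.disc_eq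
  rw [pow_two]
  apply Complex.ext
  · simp [tau, Complex.mul_re]
    linear_combination (-1 / 4) * hs - (1 / 4) * hd
  · simp [tau, Complex.mul_im]
    ring

theorem tau_sub (Q F : PosForm Δ) : Q.tau = F.tau + ((Q.b : ℂ) - F.b) / 2 := by
  apply Complex.ext
  · simp [tau]; ring
  · simp [tau]

theorem Equivalent.homothetic (hΔ : Δ < 0) {F Q : PosForm Δ} (h : F.Equivalent Q) :
    Homothetic Q.lattice F.lattice := by
  obtain ⟨p, q, r, s, h⟩ := h
  obtain ⟨ha, hb, -⟩ := h.coeffs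
  have hdet : (p : ℂ) * s - q * r = 1 := by exact_mod_cast h.1
  have haC : (Q.a : ℂ) = F.a * p ^ 2 + F.b * p * r + F.c * r ^ 2 := by
    rw [ha, eval]; push_cast; ring
  have hbC : (Q.b : ℂ) = 2 * F.a * p * q + F.b * (p * s + q * r) + 2 * F.c * r * s := by
    rw [hb]; push_cast; ring
  have ha0 : (Q.a : ℂ) ≠ 0 := by exact_mod_cast Q.a_pos.ne'
  have hts := F.tau_sq hΔ
  have hQ := Q.tau_sub F
  set t := F.tau
  have hkey : Q.tau * (p * F.a + r * t) = Q.a * (q * F.a + s * t) := by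
    rw [hQ, hbC, haC]
    linear_combination (r : ℂ) * hts -
      (t * F.a * p + t * F.b * r / 2 - F.a * F.b * p / 2 - F.a * F.c * r) * hdet
  have hw : (p * F.a + r * t : ℂ) ≠ 0 := by
    intro h0
    rw [h0, mul_zero] at hkey
    have h1 : (q * F.a + s * t : ℂ) = 0 := by
      rcases mul_eq_zero.mp hkey.symm with h | h
      · exact absurd h ha0
      · exact h
    have : (F.a : ℂ) = 0 := by
      linear_combination s * h0 - r * h1 - F.a * hdet
    exact F.a_pos.ne' (by exact_mod_cast this)
  refine ⟨(p * F.a + r * t) / Q.a, div_ne_zero hw ha0, ?_⟩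
  rw [lattice, lattice, span_mul_pair]
  have e1 : (p * F.a + r * t) / Q.a * Q.a = p * F.a + r * t := by field_simp
  have e2 : (p * F.a + r * t) / Q.a * Q.tau = q * F.a + s * t := by
    rw [div_mul_eq_mul_div, mul_comm, hkey, mul_div_cancel_left₀ _ ha0]
  rw [e1, e2]
  apply le_antisymm <;> rw [Submodule.span_le] <;> rintro x (rfl | rfl) <;>
    simp only [SetLike.mem_coe, Submodule.mem_span_pair, zsmul_eq_mul]
  · exact ⟨s, -r, by push_cast; linear_combination F.a * hdet⟩
  · exact ⟨-q, p, by push_cast; linear_combination t * hdet⟩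
  · exact ⟨p, r, rfl⟩
  · exact ⟨q, s, rfl⟩

theorem normSq_comb (hΔ : Δ < 0) (Q : PosForm Δ) (x y : ℤ) :
    Complex.normSq (x * Q.a + y * Q.tau) = Q.a * Q.eval x y := by
  have hs : Real.sqrt (-Δ) ^ 2 = -(Δ : ℝ) := Real.sq_sqrt (by
    have : (Δ : ℝ) < 0 := by exact_mod_cast hΔ
    linarith)
  have hd : (Q.b : ℝ) ^ 2 - 4 * Q.a * Q.c = Δ := by exact_mod_cast Q.disc_eq
  simp [Complex.normSq_apply, tau, eval]
  linear_combination ((y : ℝ) ^ 2 / 4) * (hs + hd)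

theorem wedge_comb (Q : PosForm Δ) (p q r s : ℤ) :
    (starRingEnd ℂ (p * Q.a + r * Q.tau) * (q * Q.a + s * Q.tau)).im =
      (p * s - q * r) * (Q.a * (Real.sqrt (-Δ) / 2)) := by
  simp [tau]
  ring

theorem wedge_smul (Q : PosForm Δ) (z : ℂ) :
    (starRingEnd ℂ (z * Q.a) * (z * Q.tau)).im =
      Complex.normSq z * (Q.a * (Real.sqrt (-Δ) / 2)) := by
  simp [tau, Complex.normSq_apply]
  ring

theorem Equivalent.of_homothetic (hΔ : Δ < 0) {F Q : PosForm Δ}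
    (h : Homothetic Q.lattice F.lattice) : F.Equivalent Q := by
  obtain ⟨z, hz, h⟩ := h
  rw [lattice, lattice, span_mul_pair] at h
  have m1 : z * Q.a ∈ Submodule.span ℤ {(F.a : ℂ), F.tau} := by
    rw [h]; exact Submodule.subset_span (by simp)
  have m2 : z * Q.tau ∈ Submodule.span ℤ {(F.a : ℂ), F.tau} := by
    rw [h]; exact Submodule.subset_span (by simp)
  have m3 : (F.a : ℂ) ∈ Submodule.span ℤ {z * Q.a, z * Q.tau} := by
    rw [← h]; exact Submodule.subset_span (by simp)
  have m4 : F.tau ∈ Submodule.span ℤ {z * Q.a, z * Q.tau} := by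
    rw [← h]; exact Submodule.subset_span (by simp)
  simp only [Submodule.mem_span_pair, zsmul_eq_mul] at m1 m2 m3 m4
  obtain ⟨p, r, e1⟩ := m1
  obtain ⟨q, s, e2⟩ := m2
  obtain ⟨p', r', e3⟩ := m3
  obtain ⟨q', s', e4⟩ := m4
  have hσ : 0 < Real.sqrt (-Δ) / 2 := by
    have : (Δ : ℝ) < 0 := by exact_mod_cast hΔ
    have : 0 < Real.sqrt (-Δ) := Real.sqrt_pos.mpr (by linarith)
    positivity
  have hn : 0 < Complex.normSq z := Complex.normSq_pos.mpr hz
  have hQa : (0 : ℝ) < Q.a := by exact_mod_cast Q.a_pos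
  have hFa : (0 : ℝ) < F.a := by exact_mod_cast F.a_pos
  have w1 : Complex.normSq z * Q.a = (p * s - q * r) * F.a := by
    have h1 := wedge_smul Q z
    rw [← e1, ← e2, wedge_comb] at h1
    have : (Complex.normSq z * Q.a - (p * s - q * r) * F.a) * (Real.sqrt (-Δ) / 2) = 0 := by
      linear_combination -h1
    rcases mul_eq_zero.mp this with h | h
    · linarith
    · exact absurd h hσ.ne'
  have w2 : (F.a : ℝ) = (p' * s' - q' * r') * (Complex.normSq z * Q.a) := by
    have h1 := wedge_smul F 1
    rw [one_mul, one_mul, ← e3, ← e4] at h1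
    have h2 : (starRingEnd ℂ (p' * (z * Q.a) + r' * (z * Q.tau)) *
        (q' * (z * Q.a) + s' * (z * Q.tau))).im =
        (p' * s' - q' * r') * (Complex.normSq z * (Q.a * (Real.sqrt (-Δ) / 2))) := by
      simp [tau, Complex.normSq_apply]
      ring
    rw [h2] at h1
    simp only [map_one] at h1
    have : ((F.a : ℝ) - (p' * s' - q' * r') * (Complex.normSq z * Q.a)) *
        (Real.sqrt (-Δ) / 2) = 0 := by
      linear_combination -h1
    rcases mul_eq_zero.mp this with h | h
    · linarith
    · exact absurd h hσ.ne'
  have hdd : ((p' * s' - q' * r' : ℤ) : ℝ) * ((p * s - q * r : ℤ) : ℝ) = 1 := by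
    rw [w1] at w2
    have : (F.a : ℝ) * ((p' * s' - q' * r') * (p * s - q * r) - 1) = 0 := by
      linear_combination -w2
    rcases mul_eq_zero.mp this with h | h
    · exact absurd h hFa.ne'
    · push_cast; linarith
  have hdd' : (p' * s' - q' * r') * (p * s - q * r) = 1 := by exact_mod_cast hdd
  have hpos : 0 < p * s - q * r := by
    have h1 : 0 < ((p : ℝ) * s - q * r) * F.a := by rw [← w1]; positivity
    have h2 : 0 < ((p : ℝ) * s - q * r) := pos_of_mul_pos_left h1 hFa.le
    exact_mod_cast h2
  have hdet : p * s - q * r = 1 := by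
    rcases Int.isUnit_iff.mp (IsUnit.of_mul_eq_one_right _ hdd') with h | h <;> omega
  have hdetR : (p : ℝ) * s - q * r = 1 := by exact_mod_cast hdet
  rw [hdetR, one_mul] at w1
  refine ⟨p, q, r, s, hdet, fun X Y => ?_⟩
  have n1 := Q.normSq_comb hΔ X Y
  have n2 := F.normSq_comb hΔ (p * X + q * Y) (r * X + s * Y)
  have e : ((p * X + q * Y : ℤ) : ℂ) * F.a + ((r * X + s * Y : ℤ) : ℂ) * F.tau =
      z * (X * Q.a + Y * Q.tau) := by
    push_cast
    linear_combination (X : ℂ) * e1 + (Y : ℂ) * e2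
  rw [e, Complex.normSq_mul, n1] at n2
  have : (F.a : ℝ) * Q.eval X Y = F.a * F.eval (p * X + q * Y) (r * X + s * Y) := by
    rw [← n2, ← w1]; ring
  exact_mod_cast mul_left_cancel₀ hFa.ne' this

theorem lattice_mul (hΔ : Δ < 0) {F₁ F₂ F₃ : PosForm Δ} (h : IsDirichletComposite F₁ F₂ F₃) :
    F₁.lattice * F₂.lattice = F₃.lattice := by
  obtain ⟨hg, hb1, hb2, hc1, hc2, ha⟩ := h
  have t1 : F₁.tau = F₃.tau := by rw [tau, tau, hb1]
  have t2 : F₂.tau = F₃.tau := by rw [tau, tau, hb2]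
  have hts := F₃.tau_sq hΔ
  have haC : (F₃.a : ℂ) = F₁.a * F₂.a := by exact_mod_cast ha
  have hbez : ∃ u v w : ℤ, F₁.a * u + F₂.a * v + F₃.b * w = 1 := by
    have h1 := Int.gcd_eq_gcd_ab (Int.gcd F₁.a F₂.a) F₃.b
    have h2 := Int.gcd_eq_gcd_ab F₁.a F₂.a
    rw [hg] at h1
    set g := Int.gcdA (Int.gcd F₁.a F₂.a) F₃.b
    refine ⟨Int.gcdA F₁.a F₂.a * g, Int.gcdB F₁.a F₂.a * g,
      Int.gcdB (Int.gcd F₁.a F₂.a) F₃.b, ?_⟩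
    push_cast at h1
    linear_combination -h1 - g * h2
  obtain ⟨u, v, w, hbez⟩ := hbez
  have hbC : (F₁.a : ℂ) * u + F₂.a * v + F₃.b * w = 1 := by exact_mod_cast hbez
  rw [lattice, lattice, lattice, t1, t2]
  set t := F₃.tau
  apply le_antisymm
  · rw [Submodule.span_mul_span, Submodule.span_le]
    rintro x ⟨y, hy, z, hz, rfl⟩
    simp only [SetLike.mem_coe, Submodule.mem_span_pair, zsmul_eq_mul]
    rcases hy with rfl | rfl <;> rcases hz with rfl | rfl
    · exact ⟨1, 0, by push_cast; linear_combination haC⟩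
    · exact ⟨0, F₁.a, by push_cast; ring⟩
    · exact ⟨0, F₂.a, by push_cast; ring⟩
    · exact ⟨-F₃.c, F₃.b, by push_cast; linear_combination -hts⟩
  · have k1 : (F₁.a : ℂ) * F₂.a ∈
        Submodule.span ℤ {(F₁.a : ℂ), t} * Submodule.span ℤ {(F₂.a : ℂ), t} :=
      Submodule.mul_mem_mul (Submodule.subset_span (by simp)) (Submodule.subset_span (by simp))
    have k2 : (F₁.a : ℂ) * t ∈
        Submodule.span ℤ {(F₁.a : ℂ), t} * Submodule.span ℤ {(F₂.a : ℂ), t} :=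
      Submodule.mul_mem_mul (Submodule.subset_span (by simp)) (Submodule.subset_span (by simp))
    have k3 : t * F₂.a ∈
        Submodule.span ℤ {(F₁.a : ℂ), t} * Submodule.span ℤ {(F₂.a : ℂ), t} :=
      Submodule.mul_mem_mul (Submodule.subset_span (by simp)) (Submodule.subset_span (by simp))
    have k4 : t * t ∈
        Submodule.span ℤ {(F₁.a : ℂ), t} * Submodule.span ℤ {(F₂.a : ℂ), t} :=
      Submodule.mul_mem_mul (Submodule.subset_span (by simp)) (Submodule.subset_span (by simp))
    rw [Submodule.span_le]
    rintro x (rfl | rfl) <;> rw [SetLike.mem_coe]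
    · rw [haC]; exact k1
    · have := Submodule.add_mem _ (Submodule.add_mem _ (Submodule.smul_mem _ u k2)
        (Submodule.smul_mem _ v k3)) (Submodule.smul_mem _ w
          (Submodule.add_mem _ k4 (Submodule.smul_mem _ F₃.c k1)))
      convert this using 1
      simp only [zsmul_eq_mul]
      linear_combination (-F₃.tau) * hbC - w * hts + w * F₃.c * haC

/-- A form represents primitively some integer coprime to `n`. -/
theorem exists_coprime_rep (hf : IsFundamentalDiscriminant Δ) (Q : PosForm Δ) (n : ℕ)
    (hn : n ≠ 0) : ∃ x y : ℤ, IsCoprime x y ∧ ∀ p : ℕ, p.Prime → p ∣ n → ¬ (p : ℤ) ∣ Q.eval x y := by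
  classical
  let S : Finset ℕ := n.primeFactors.filter (fun p => (p : ℤ) ∣ Q.a ∧ ¬ (p : ℤ) ∣ Q.c)
  let T : Finset ℕ := n.primeFactors.filter (fun p => ¬ (p : ℤ) ∣ Q.a)
  have hmem : ∀ (U : Finset ℕ), U ⊆ n.primeFactors → ∀ p : ℕ, p.Prime →
      ((p : ℤ) ∣ ((∏ q ∈ U, q : ℕ) : ℤ) ↔ p ∈ U) := by
    intro U hU p hp
    rw [Int.natCast_dvd_natCast]
    constructor
    · intro h
      obtain ⟨q, hq, hpq⟩ := (Prime.dvd_finsetProd_iff hp.prime _).mp h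
      rwa [(Nat.prime_dvd_prime_iff_eq hp (Nat.prime_of_mem_primeFactors (hU hq))).mp hpq]
    · intro h
      exact Finset.dvd_prod_of_mem _ h
  have hS := hmem S (Finset.filter_subset _ _)
  have hT := hmem T (Finset.filter_subset _ _)
  refine ⟨((∏ q ∈ S, q : ℕ) : ℤ), ((∏ q ∈ T, q : ℕ) : ℤ), ?_, ?_⟩
  · rw [Nat.isCoprime_iff_coprime]
    apply Nat.Coprime.prod_left
    intro q hq
    apply Nat.Coprime.prod_right
    intro q' hq'
    have h1 := Nat.prime_of_mem_primeFactors (Finset.mem_of_mem_filter _ hq)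
    have h2 := Nat.prime_of_mem_primeFactors (Finset.mem_of_mem_filter _ hq')
    rw [Nat.coprime_primes h1 h2]
    rintro rfl
    exact (Finset.mem_filter.mp hq').2 (Finset.mem_filter.mp hq).2.1
  · intro p hp hpn hdvd
    have hpn' : p ∈ n.primeFactors := Nat.mem_primeFactors.mpr ⟨hp, hpn, hn⟩
    have hpp : Prime (p : ℤ) := Nat.prime_iff_prime_int.mp hp
    have hS' := hS p hp
    have hT' := hT p hp
    generalize ((∏ q ∈ S, q : ℕ) : ℤ) = x at *
    generalize ((∏ q ∈ T, q : ℕ) : ℤ) = y at *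
    simp only [S, T, Finset.mem_filter, hpn', true_and] at hS' hT'
    rw [eval] at hdvd
    by_cases ha : (p : ℤ) ∣ Q.a
    · have hy : ¬ (p : ℤ) ∣ y := fun h => hT'.mp h ha
      by_cases hc : (p : ℤ) ∣ Q.c
      · have hx : ¬ (p : ℤ) ∣ x := fun h => (hS'.mp h).2 hc
        have : (p : ℤ) ∣ Q.b * x * y := by
          have h1 : (p : ℤ) ∣ Q.a * x ^ 2 + Q.c * y ^ 2 :=
            dvd_add (ha.mul_right _) (hc.mul_right _)
          have h2 := dvd_sub hdvd h1
          ring_nf at h2 ⊢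
          exact h2
        rcases hpp.dvd_or_dvd this with h | h
        · rcases hpp.dvd_or_dvd h with h | h
          · exact Q.primitive hf p hp ha h hc
          · exact hx h
        · exact hy h
      · have hx : (p : ℤ) ∣ x := hS'.mpr ⟨ha, hc⟩
        have : (p : ℤ) ∣ Q.c * y ^ 2 := by
          have h1 : (p : ℤ) ∣ Q.a * x ^ 2 + Q.b * x * y :=
            dvd_add (ha.mul_right _) ((hx.mul_left _).mul_right _)
          exact (dvd_add_right h1).mp hdvd
        rcases hpp.dvd_or_dvd this with h | h
        · exact hc h
        · exact hy (hpp.dvd_of_dvd_pow h)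
    · have hy : (p : ℤ) ∣ y := hT'.mpr ha
      have hx : ¬ (p : ℤ) ∣ x := fun h => ha (hS'.mp h).1
      have : (p : ℤ) ∣ Q.a * x ^ 2 := by
        have h1 : (p : ℤ) ∣ Q.b * x * y + Q.c * y ^ 2 :=
          dvd_add (hy.mul_left _) ((dvd_pow hy two_ne_zero).mul_left _)
        rw [add_assoc] at hdvd
        exact (dvd_add_left h1).mp hdvd
      rcases hpp.dvd_or_dvd this with h | h
      · exact ha h
      · exact hx (hpp.dvd_of_dvd_pow h)

/-- Any two forms are equivalent to forms that can be composed. -/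
theorem exists_composite (hΔ : Δ < 0) (hf : IsFundamentalDiscriminant Δ) (Q₁ Q₂ : PosForm Δ) :
    ∃ F₁ F₂ F₃ : PosForm Δ, Q₁.Equivalent F₁ ∧ Q₂.Equivalent F₂ ∧
      IsDirichletComposite F₁ F₂ F₃ := by
  obtain ⟨x, y, ⟨v, w, hxy⟩, hcop⟩ := Q₂.exists_coprime_rep hf Q₁.a.natAbs
    (by have := Q₁.a_pos; omega)
  obtain ⟨G, hG⟩ := Q₂.exists_transform hΔ (x := x) (u := -w) (y := y) (v := v)
    (by linarith)
  rw [← hG.coeffs.1] at hcop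
  have hgcd : IsCoprime Q₁.a G.a := by
    rw [Int.isCoprime_iff_gcd_eq_one]
    by_contra hne
    obtain ⟨p, hp, hpd⟩ := Nat.exists_prime_and_dvd hne
    have h1 : (p : ℤ) ∣ Q₁.a := (Int.natCast_dvd_natCast.mpr hpd).trans (Int.gcd_dvd_left _ _)
    have h2 : (p : ℤ) ∣ G.a := (Int.natCast_dvd_natCast.mpr hpd).trans (Int.gcd_dvd_right _ _)
    exact hcop p hp (Int.natCast_dvd.mp h1) h2
  have hpar : ∃ m, G.b - Q₁.b = 2 * m := by
    have h1 := Q₁.disc_eq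
    have h2 := G.disc_eq
    have h3 : Even ((G.b - Q₁.b) * (G.b + Q₁.b)) :=
      ⟨2 * (G.a * G.c - Q₁.a * Q₁.c), by linear_combination h2 - h1⟩
    have h4 : Even (G.b - Q₁.b) := by
      rcases Int.even_mul.mp h3 with h | h
      · exact h
      · have : G.b - Q₁.b = (G.b + Q₁.b) - 2 * Q₁.b := by ring
        rw [this]
        exact h.sub (even_two_mul _)
    obtain ⟨m, hm⟩ := h4
    exact ⟨m, by omega⟩
  obtain ⟨m, hm⟩ := hpar
  have hgcd' := hgcd
  obtain ⟨α, β, hαβ⟩ := hgcd'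
  obtain ⟨F₁, e1, a1, b1⟩ := Q₁.exists_shift hΔ (α * m)
  obtain ⟨F₂, e2, a2, b2⟩ := G.exists_shift hΔ (-(β * m))
  have hb : F₁.b = F₂.b := by
    rw [b1, b2]
    linear_combination (2 * m) * hαβ - hm
  have hac : F₁.a * F₁.c = F₂.a * F₂.c := by
    have h1 := F₁.disc_eq
    have h2 := F₂.disc_eq
    rw [hb] at h1
    linarith
  rw [← a1, ← a2] at hgcd
  obtain ⟨c, hc⟩ : F₂.a ∣ F₁.c :=
    hgcd.symm.dvd_of_dvd_mul_left ⟨F₂.c, hac⟩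
  refine ⟨F₁, F₂, ⟨F₁.a * F₂.a, F₁.b, c, mul_pos F₁.a_pos F₂.a_pos, ?_⟩, e1,
    Equivalent.trans ⟨_, _, _, _, hG⟩ e2, ?_, rfl, hb.symm, hc, ?_, rfl⟩
  · have h1 := F₁.disc_eq
    rw [hc] at h1
    linear_combination h1
  · rw [Int.isCoprime_iff_gcd_eq_one.mp hgcd]
    simp
  · have h2 : F₂.a ≠ 0 := F₂.a_pos.ne'
    apply mul_left_cancel₀ h2
    rw [← hac]
    linear_combination F₁.a * hc

/-- The opposite form `(a, -b, c)`. -/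
def opposite (Q : PosForm Δ) : PosForm Δ where
  a := Q.a
  b := -Q.b
  c := Q.c
  a_pos := Q.a_pos
  disc_eq := by have := Q.disc_eq; linear_combination this

theorem opposite_equivalent {Q F : PosForm Δ} (h : Q.Equivalent F) :
    Q.opposite.Equivalent F.opposite := by
  obtain ⟨x, u, y, v, hd, h⟩ := h
  refine ⟨x, -u, -y, v, by linarith, fun X Y => ?_⟩
  have := h X (-Y)
  simp only [eval, opposite] at *
  linear_combination this

end PosForm

namespace FormClassGroup

variable {Δ : ℤ}

/-- Two classes have a composite class, which is the composite of all composable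
representatives. -/
theorem exists_mul (hΔ : Δ < 0) (hf : IsFundamentalDiscriminant Δ) (X Y : FormClassGroup Δ) :
    ∃ Z : FormClassGroup Δ, ∃ F₁ F₂ F₃ : PosForm Δ, IsDirichletComposite F₁ F₂ F₃ ∧
      F₁.toClass = X ∧ F₂.toClass = Y ∧ F₃.toClass = Z := by
  obtain ⟨Q₁, rfl⟩ := X.exists_rep
  obtain ⟨Q₂, rfl⟩ := Y.exists_rep
  obtain ⟨F₁, F₂, F₃, h1, h2, h⟩ := PosForm.exists_composite hΔ hf Q₁ Q₂
  exact ⟨_, F₁, F₂, F₃, h, PosForm.toClass_eq.mpr h1.symm, PosForm.toClass_eq.mpr h2.symm, rfl⟩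

variable [hΔ : Fact (Δ < 0)] [hf : Fact (IsFundamentalDiscriminant Δ)]

/-- Composition of classes: choose composable representatives and take the class of their
Dirichlet composite (see `toClass_mul_toClass` for the independence of the choice). -/
noncomputable instance : Mul (FormClassGroup Δ) :=
  ⟨fun X Y => (exists_mul hΔ.out hf.out X Y).choose⟩

/-- The neutral class is the class of the principal form. -/
noncomputable instance : One (FormClassGroup Δ) := ⟨(principalForm Δ).toClass⟩

/-- The inverse of the class of `(a, b, c)` is the class of `(a, -b, c)`. -/
noncomputable instance : Inv (FormClassGroup Δ) :=
  ⟨Quotient.map PosForm.opposite fun _ _ h => PosForm.opposite_equivalent h⟩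

set_option linter.unusedSectionVars false in
theorem inv_toClass (Q : PosForm Δ) : (Q.toClass)⁻¹ = Q.opposite.toClass := rfl

set_option linter.unusedSectionVars false in
theorem one_eq : (1 : FormClassGroup Δ) = (principalForm Δ).toClass := rfl

theorem homothetic_of_mul {Q₁ Q₂ Q₃ : PosForm Δ} (h : Q₁.toClass * Q₂.toClass = Q₃.toClass) :
    PosForm.Homothetic (Q₁.lattice * Q₂.lattice) Q₃.lattice := by
  obtain ⟨F₁, F₂, F₃, hF, h1, h2, h3⟩ :=
    (exists_mul hΔ.out hf.out Q₁.toClass Q₂.toClass).choose_spec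
  have h3' : F₃.toClass = Q₃.toClass := h3.trans h
  have k1 := (PosForm.toClass_eq.mp h1).homothetic hΔ.out
  have k2 := (PosForm.toClass_eq.mp h2).homothetic hΔ.out
  have k3 := (PosForm.toClass_eq.mp h3').homothetic hΔ.out
  have := k1.mul k2
  rw [PosForm.lattice_mul hΔ.out hF] at this
  exact this.trans k3.symm

theorem mul_eq_iff {Q₁ Q₂ Q₃ : PosForm Δ} : Q₁.toClass * Q₂.toClass = Q₃.toClass ↔
    PosForm.Homothetic (Q₁.lattice * Q₂.lattice) Q₃.lattice := by
  refine ⟨homothetic_of_mul, fun h => ?_⟩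
  obtain ⟨Q, hQ⟩ := (Q₁.toClass * Q₂.toClass).exists_rep
  rw [← hQ, PosForm.toClass_eq]
  exact PosForm.Equivalent.of_homothetic hΔ.out (h.symm.trans (homothetic_of_mul hQ.symm))

/-- The product of classes is given by Dirichlet composition of any composable
representatives. -/
theorem toClass_mul_toClass {F₁ F₂ F₃ : PosForm Δ} (h : IsDirichletComposite F₁ F₂ F₃) :
    F₁.toClass * F₂.toClass = F₃.toClass := by
  rw [mul_eq_iff, PosForm.lattice_mul hΔ.out h]
  exact PosForm.Homothetic.refl _

theorem mul_comm' (X Y : FormClassGroup Δ) : X * Y = Y * X := by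
  obtain ⟨Q₁, rfl⟩ := X.exists_rep
  obtain ⟨Q₂, rfl⟩ := Y.exists_rep
  obtain ⟨Q₃, h⟩ := (Q₂.toClass * Q₁.toClass).exists_rep
  rw [← h, mul_eq_iff, mul_comm]
  exact homothetic_of_mul h.symm

theorem mul_assoc' (X Y Z : FormClassGroup Δ) : X * Y * Z = X * (Y * Z) := by
  obtain ⟨Q₁, rfl⟩ := X.exists_rep
  obtain ⟨Q₂, rfl⟩ := Y.exists_rep
  obtain ⟨Q₃, rfl⟩ := Z.exists_rep
  obtain ⟨P, hP⟩ := (Q₁.toClass * Q₂.toClass).exists_rep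
  obtain ⟨R, hR⟩ := (Q₂.toClass * Q₃.toClass).exists_rep
  obtain ⟨S, hS⟩ := (Q₁.toClass * R.toClass).exists_rep
  rw [← hP, ← hR, ← hS, mul_eq_iff]
  have k1 := (homothetic_of_mul hP.symm).mul (PosForm.Homothetic.refl Q₃.lattice)
  have k2 := (PosForm.Homothetic.refl Q₁.lattice).mul (homothetic_of_mul hR.symm)
  have k3 := homothetic_of_mul hS.symm
  rw [mul_assoc] at k1
  exact k1.symm.trans (k2.trans k3)

theorem toClass_eq_one {Q : PosForm Δ} (ha : Q.a = 1) : Q.toClass = 1 := by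
  obtain ⟨k, hk⟩ : ∃ k, Q.b = Δ % 2 + 2 * k := by
    have h1 := Q.disc_eq
    have h2 : (Q.b ^ 2) % 2 = Δ % 2 := by
      have : Q.b ^ 2 = Δ + 2 * (2 * (Q.a * Q.c)) := by linarith
      rw [this]; omega
    have h3 : (Q.b ^ 2) % 2 = Q.b % 2 := by
      rcases Int.even_or_odd' Q.b with ⟨j, h | h⟩ <;> rw [h] <;> ring_nf <;> omega
    exact ⟨(Q.b - Δ % 2) / 2, by omega⟩
  obtain ⟨F, hF, ha', hb⟩ := (principalForm Δ).exists_shift hΔ.out k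
  have h1 : F.a = 1 := ha'
  have h2 : F.b = Q.b := by
    rw [hb, hk]
    simp [principalForm]
  have hFQ : F = Q := by
    ext
    · rw [h1, ha]
    · exact h2
    · have h3 := F.disc_eq
      have h4 := Q.disc_eq
      rw [h1, h2] at h3
      rw [ha] at h4
      linarith
  rw [one_eq, PosForm.toClass_eq.mpr hF, hFQ]

theorem one_mul' (X : FormClassGroup Δ) : 1 * X = X := by
  obtain ⟨Q, rfl⟩ := X.exists_rep
  let F : PosForm Δ := ⟨1, Q.b, Q.a * Q.c, one_pos, by have := Q.disc_eq; linarith⟩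
  rw [← toClass_eq_one (Q := F) rfl]
  refine toClass_mul_toClass ⟨?_, rfl, rfl, rfl, ?_, ?_⟩ <;> simp [F]

theorem inv_mul' (X : FormClassGroup Δ) : X⁻¹ * X = 1 := by
  obtain ⟨Q, rfl⟩ := X.exists_rep
  have hΔ' := hΔ.out
  -- the opposite class contains `(c, b, a)`
  let G : PosForm Δ := ⟨Q.c, Q.b, Q.a, Q.c_pos hΔ', by have := Q.disc_eq; linarith⟩
  have hG : Q.opposite.Equivalent G :=
    ⟨0, -1, 1, 0, by norm_num, fun X Y => by simp only [G, PosForm.eval, PosForm.opposite]; ring⟩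
  let H : PosForm Δ := ⟨Q.c * Q.a, Q.b, 1, mul_pos (Q.c_pos hΔ') Q.a_pos,
    by have := Q.disc_eq; linarith⟩
  have hGH : IsDirichletComposite G Q H := by
    refine ⟨?_, rfl, rfl, ?_, ?_, rfl⟩
    · by_contra hne
      obtain ⟨p, hp, hpd⟩ := Nat.exists_prime_and_dvd hne
      have h0 : (p : ℤ) ∣ Int.gcd G.a Q.a :=
        (Int.natCast_dvd_natCast.mpr hpd).trans (Int.gcd_dvd_left _ _)
      have h1 : (p : ℤ) ∣ Q.b := (Int.natCast_dvd_natCast.mpr hpd).trans (Int.gcd_dvd_right _ _)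
      exact Q.primitive hf.out p hp (h0.trans (Int.gcd_dvd_right _ _)) h1
        (h0.trans (Int.gcd_dvd_left _ _))
    · simp [G, H]
    · simp [G, H]
  let P : PosForm Δ := ⟨1, -Q.b, Q.c * Q.a, one_pos, by have := Q.disc_eq; linarith⟩
  have hHP : H.Equivalent P :=
    ⟨0, -1, 1, 0, by norm_num, fun X Y => by simp only [P, H, PosForm.eval]; ring⟩
  rw [inv_toClass, PosForm.toClass_eq.mpr hG, toClass_mul_toClass hGH,
    PosForm.toClass_eq.mpr hHP, toClass_eq_one rfl]

/-- The class group `Cl(Δ)`: classes of forms under Dirichlet composition. -/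
noncomputable instance : CommGroup (FormClassGroup Δ) where
  mul_assoc := mul_assoc'
  one_mul := one_mul'
  mul_one X := by rw [mul_comm', one_mul']
  inv_mul_cancel := inv_mul'
  mul_comm := mul_comm'

end FormClassGroup

/-! ### The Šimerka map -/

/-- The integer `β` with `-p < β ≤ p` and `β ≡ B mod 2p` (for `p > 0`). -/
def centeredResidue (p : ℕ) (B : ℤ) : ℤ :=
  if B % (2 * p) ≤ p then B % (2 * p) else B % (2 * p) - 2 * p

theorem centeredResidue_spec {p : ℕ} (hp : 0 < p) (B β : ℤ) :
    centeredResidue p B = β ↔ -(p : ℤ) < β ∧ β ≤ p ∧ β ≡ B [ZMOD 2 * p] := by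
  have h1 := Int.emod_nonneg B (b := 2 * p) (by omega)
  have h2 := Int.emod_lt_of_pos B (b := 2 * p) (by omega)
  have h3 := Int.mul_ediv_add_emod B (2 * p)
  rw [Int.modEq_iff_dvd, centeredResidue]
  constructor
  · intro h
    split_ifs at h with hc
    · exact ⟨by omega, by omega, B / (2 * p), by linarith⟩
    · exact ⟨by omega, by omega, B / (2 * p) + 1, by linarith⟩
  · rintro ⟨h4, h5, k, hk⟩
    by_cases hβ : 0 ≤ β
    · have : B % (2 * p) = β := by
        rw [show B = β + 2 * p * k by linarith, Int.add_mul_emod_self_left]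
        exact Int.emod_eq_of_lt hβ (by omega)
      rw [this, if_pos h5]
    · have : B % (2 * p) = β + 2 * p := by
        rw [show B = β + 2 * p + 2 * p * (k - 1) by linarith, Int.add_mul_emod_self_left]
        exact Int.emod_eq_of_lt (by omega) (by omega)
      rw [this, if_neg (by omega)]
      ring

/-- The sign `s = ±1` of the prime `p` with respect to the middle coefficient `B`. -/
def simerkaSign (p : ℕ) (B : ℤ) : ℤ := if 0 ≤ centeredResidue p B then 1 else -1

/-- The signed factorization `∏ p ^ (s_p · v_p(a))` over the primes `p ∣ a`. -/
def signedFactorization (a : ℕ) (B : ℤ) : ℚ :=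
  ∏ p ∈ a.primeFactors, (p : ℚ) ^ (simerkaSign p B * (a.factorization p : ℤ))

theorem signedFactorization_ne_zero (a : ℕ) (B : ℤ) : signedFactorization a B ≠ 0 := by
  rw [signedFactorization, Finset.prod_ne_zero_iff]
  intro p hp
  exact zpow_ne_zero _ (by exact_mod_cast (Nat.prime_of_mem_primeFactors hp).ne_zero)

/-- `r` is the Šimerka value `š(Q, a)` belonging to the representation `a = Q(x, y)`: the form
`Q` is carried to some `F = (a, B, C)` with `-a < B ≤ a` by a matrix in `SL₂(ℤ)` with first
column `(x, y)`, and `r` is the signed factorization of `a` with respect to `B`. -/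
def PosForm.IsSimerkaValue {Δ : ℤ} (Q : PosForm Δ) (x y : ℤ) (r : ℚˣ) : Prop :=
  ∃ (u v : ℤ) (F : PosForm Δ), Q.IsTransform x u y v F ∧ -F.a < F.b ∧ F.b ≤ F.a ∧
    (r : ℚ) = signedFactorization F.a.toNat F.b

/-- Every primitive representation has exactly one Šimerka value. -/
theorem PosForm.existsUnique_isSimerkaValue {Δ : ℤ} (hΔ : Δ < 0) (Q : PosForm Δ) {x y : ℤ}
    (h : IsCoprime x y) : ∃! r : ℚˣ, Q.IsSimerkaValue x y r := by
  obtain ⟨v, w, hvw⟩ := h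
  obtain ⟨G, hG⟩ := Q.exists_transform hΔ (x := x) (u := -w) (y := y) (v := v) (by linarith)
  obtain ⟨hGa, hGb, -⟩ := hG.coeffs
  have ha := G.a_pos
  obtain ⟨k, hk1, hk2⟩ : ∃ k : ℤ, -G.a < G.b + 2 * G.a * k ∧ G.b + 2 * G.a * k ≤ G.a := by
    have h1 := Int.emod_nonneg (G.a - G.b) (b := 2 * G.a) (by omega)
    have h2 := Int.emod_lt_of_pos (G.a - G.b) (b := 2 * G.a) (by omega)
    have h3 := Int.mul_ediv_add_emod (G.a - G.b) (2 * G.a)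
    exact ⟨(G.a - G.b) / (2 * G.a), by linarith, by linarith⟩
  obtain ⟨F, hF⟩ := Q.exists_transform hΔ (x := x) (u := -w + x * k) (y := y) (v := v + y * k)
    (by linear_combination hvw)
  obtain ⟨hFa, hFb, -⟩ := hF.coeffs
  have hab : F.a = G.a := by rw [hFa, hGa]
  have hbb : F.b = G.b + 2 * G.a * k := by
    rw [hFb, hGb, hGa, PosForm.eval]; ring
  refine ⟨Units.mk0 _ (signedFactorization_ne_zero F.a.toNat F.b),
    ⟨_, _, F, hF, by omega, by omega, rfl⟩, ?_⟩
  rintro r ⟨u', v', F', hF', h1, h2, hr⟩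
  obtain ⟨hFa', hFb', -⟩ := hF'.coeffs
  have haa : F'.a = F.a := by rw [hFa', hFa]
  have hd := hF.1
  have hd' := hF'.1
  have hu : u' - (-w + x * k) = x * (v * u' + w * v' - k) := by
    linear_combination (-u') * hvw - w * hd'
  have hv : v' - (v + y * k) = y * (v * u' + w * v' - k) := by
    linear_combination (-v') * hvw + v * hd'
  have hb : F'.b = F.b + 2 * F.a * (v * u' + w * v' - k) := by
    rw [hFb', hFb, hFa, PosForm.eval]
    linear_combination (2 * Q.a * x + Q.b * y) * hu + (Q.b * x + 2 * Q.c * y) * hv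
  generalize v * u' + w * v' - k = j at hb
  have hj : j = 0 := by
    rw [haa] at h1 h2
    have hFpos := F.a_pos
    have k1 : -F.a < F.b := by omega
    have k2 : F.b ≤ F.a := by omega
    have l1 : F.a * j < F.a * 1 := by linarith
    have l2 : F.a * (-1) < F.a * j := by linarith
    have := lt_of_mul_lt_mul_left l1 hFpos.le
    have := lt_of_mul_lt_mul_left l2 hFpos.le
    omega
  rw [hj, mul_zero, add_zero] at hb
  apply Units.ext
  rw [hr, haa, hb, Units.val_mk0]

/-- The subgroup `ℛ` of `ℚˣ` generated by the Šimerka values of the principal form. -/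
def simerkaRelations (Δ : ℤ) [Fact (IsFundamentalDiscriminant Δ)] : Subgroup ℚˣ :=
  Subgroup.closure {r : ℚˣ | ∃ x y : ℤ, IsCoprime x y ∧ (principalForm Δ).IsSimerkaValue x y r}

/-! To a form F = (a, b, c), normalized or not, attach the signed factorization š(F) of a with
respect to b. It depends only on a and on b mod 2a, and it is multiplicative under Dirichlet
composition: the factors (a₁, b, ·) and (a₂, b, ·) share the middle coefficient, so every prime has
the same sign in both and the exponents simply add (`PosForm.simerka_mul`).

Well-definedness modulo ℛ: every form in the principal class has its value in ℛ. If F and G are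
equivalent, pick K in the inverse class with leading coefficient prime to those of F and G. The
composites of F and of G with K are principal, so š(F)š(K) and š(G)š(K) both lie in ℛ, hence so does
š(F)⁻¹š(G) (`PosForm.simerka_congr_of_equivalent`). Composing representatives with coprime leading
coefficients then gives the homomorphism property.

Injectivity: there is a homomorphism ψ from ℚˣ to Cl(Δ) with ψ(š(F)) = [F] for all F
(`exists_hom_simerka`). For a prime p the forms (p, b, ·) of sign +1 make up at most one class, and
those of sign -1 lie in its inverse; let ψ send p to that class. Splitting primes off the leading
coefficient extends the identity to all forms. As ψ is trivial on the generators of ℛ, it recovers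
the class of F from š(F) mod ℛ. -/

/-! ### Signed factorizations of integers -/

theorem centeredResidue_congr {p : ℕ} {B B' : ℤ} (h : B ≡ B' [ZMOD 2 * p]) :
    centeredResidue p B = centeredResidue p B' := by
  unfold centeredResidue
  rw [h.eq]

theorem simerkaSign_congr {p : ℕ} {B B' : ℤ} (h : B ≡ B' [ZMOD 2 * p]) :
    simerkaSign p B = simerkaSign p B' := by
  rw [simerkaSign, simerkaSign, centeredResidue_congr h]

theorem signedFactorization_congr {a : ℕ} {B B' : ℤ} (h : B ≡ B' [ZMOD 2 * a]) :
    signedFactorization a B = signedFactorization a B' := by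
  refine Finset.prod_congr rfl fun p hp => ?_
  have hpa : (p : ℤ) ∣ a := Int.natCast_dvd_natCast.mpr (Nat.dvd_of_mem_primeFactors hp)
  rw [simerkaSign_congr (h.of_dvd (mul_dvd_mul_left 2 hpa))]

/-- The sign of p depends on B alone, so for fixed B the exponent of p is a constant times the
additive p-adic valuation. No coprimality of the factors is needed. -/
theorem signedFactorization_mul {m n : ℕ} (hm : m ≠ 0) (hn : n ≠ 0) (B : ℤ) :
    signedFactorization (m * n) B = signedFactorization m B * signedFactorization n B := by
  have key : ∀ a : ℕ, signedFactorization a B =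
      a.factorization.prod fun p k => (p : ℚ) ^ (simerkaSign p B * (k : ℤ)) := fun _ => rfl
  rw [key, key, key, Nat.factorization_mul hm hn]
  refine Finsupp.prod_add_index (fun p _ => by simp) fun p hp k l => ?_
  have hp0 : (p : ℚ) ≠ 0 := by
    have hprime : p.Prime := by
      rcases Finset.mem_union.mp hp with h | h <;>
        exact Nat.prime_of_mem_primeFactors (Nat.support_factorization _ ▸ h)
    exact_mod_cast hprime.ne_zero
  rw [← zpow_add₀ hp0]
  push_cast
  rw [mul_add]

theorem signedFactorization_one (B : ℤ) : signedFactorization 1 B = 1 := by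
  simp [signedFactorization]

theorem signedFactorization_prime {p : ℕ} (hp : p.Prime) (B : ℤ) :
    signedFactorization p B = (p : ℚ) ^ simerkaSign p B := by
  simp [signedFactorization, hp.primeFactors, hp.factorization]

/-! ### Signed factorizations of forms, translations and coprime representatives -/

namespace PosForm

variable {Δ : ℤ}

/-- The signed factorization of the leading coefficient of a form. -/
def simerka (F : PosForm Δ) : ℚˣ :=
  Units.mk0 _ (signedFactorization_ne_zero F.a.toNat F.b)

theorem toNat_a (F : PosForm Δ) : (F.a.toNat : ℤ) = F.a := Int.toNat_of_nonneg F.a_pos.le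

theorem simerka_congr {F G : PosForm Δ} (ha : F.a = G.a) (hb : F.b ≡ G.b [ZMOD 2 * G.a]) :
    F.simerka = G.simerka := by
  apply Units.ext
  simp only [simerka, Units.val_mk0]
  rw [ha]
  exact signedFactorization_congr (by rwa [G.toNat_a])

/-- Dirichlet composition keeps the middle coefficient, which is exactly what makes the signs of the
two factors agree. -/
theorem simerka_mul {F G H : PosForm Δ} (ha : H.a = F.a * G.a) (hF : F.b = H.b)
    (hG : G.b = H.b) : H.simerka = F.simerka * G.simerka := by
  apply Units.ext
  have hF0 := F.a_pos
  have hG0 := G.a_pos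
  simp only [simerka, Units.val_mk0, Units.val_mul]
  rw [ha, hF, hG, Int.toNat_mul hF0.le hG0.le, signedFactorization_mul (by omega) (by omega)]

theorem ext_a_b {F G : PosForm Δ} (ha : F.a = G.a) (hb : F.b = G.b) : F = G := by
  ext
  · exact ha
  · exact hb
  · have h1 := F.disc_eq
    have h2 := G.disc_eq
    rw [ha, hb] at h1
    have h3 := G.a_pos
    have h4 : G.a * F.c = G.a * G.c := by linarith
    exact mul_left_cancel₀ h3.ne' h4

theorem equivalent_of_modEq (hΔ : Δ < 0) {F G : PosForm Δ} (ha : F.a = G.a)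
    (hb : F.b ≡ G.b [ZMOD 2 * G.a]) : F.Equivalent G := by
  obtain ⟨k, hk⟩ := hb.dvd
  obtain ⟨H, hH, hHa, hHb⟩ := F.exists_shift hΔ k
  rwa [ext_a_b (hHa.trans ha) (by rw [hHb, ha]; linarith)] at hH

theorem exists_normalized (hΔ : Δ < 0) (F : PosForm Δ) :
    ∃ G : PosForm Δ, F.Equivalent G ∧ -G.a < G.b ∧ G.b ≤ G.a ∧ F.simerka = G.simerka := by
  have ha := F.a_pos
  have h1 := Int.emod_nonneg (F.a - F.b) (b := 2 * F.a) (by omega)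
  have h2 := Int.emod_lt_of_pos (F.a - F.b) (b := 2 * F.a) (by omega)
  have h3 := Int.mul_ediv_add_emod (F.a - F.b) (2 * F.a)
  -- With this quotient the new middle coefficient is a minus the remainder of a - b modulo 2a,
  -- hence lies in (-a, a].
  obtain ⟨G, hG, hGa, hGb⟩ := F.exists_shift hΔ ((F.a - F.b) / (2 * F.a))
  refine ⟨G, hG, by linarith, by linarith, simerka_congr hGa.symm ?_⟩
  exact Int.modEq_iff_dvd.mpr ⟨(F.a - F.b) / (2 * F.a), by rw [hGb, hGa]; ring⟩

/-- Supplies the freedom to move a form within its class so that it composes with given forms; it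
rests on primitivity, which holds because Δ is fundamental. -/
theorem exists_coprime (hΔ : Δ < 0) (hf : IsFundamentalDiscriminant Δ) (Q : PosForm Δ) {n : ℤ}
    (hn : n ≠ 0) : ∃ G : PosForm Δ, Q.Equivalent G ∧ IsCoprime n G.a := by
  obtain ⟨x, y, ⟨v, w, hxy⟩, hcop⟩ := Q.exists_coprime_rep hf n.natAbs (by omega)
  obtain ⟨G, hG⟩ := Q.exists_transform hΔ (x := x) (u := -w) (y := y) (v := v) (by linarith)
  rw [← hG.coeffs.1] at hcop
  refine ⟨G, ⟨_, _, _, _, hG⟩, ?_⟩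
  rw [Int.isCoprime_iff_gcd_eq_one]
  by_contra hne
  obtain ⟨p, hp, hpd⟩ := Nat.exists_prime_and_dvd hne
  exact hcop p hp (Int.natCast_dvd.mp ((Int.natCast_dvd_natCast.mpr hpd).trans
    (Int.gcd_dvd_left _ _))) ((Int.natCast_dvd_natCast.mpr hpd).trans (Int.gcd_dvd_right _ _))

theorem b_modEq_two (F G : PosForm Δ) : F.b ≡ G.b [ZMOD 2] := by
  have h1 := F.disc_eq
  have h2 := G.disc_eq
  have h3 : Even ((F.b - G.b) * (F.b + G.b)) :=
    ⟨2 * (F.a * F.c - G.a * G.c), by linear_combination h1 - h2⟩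
  rw [Int.modEq_iff_dvd]
  rcases Int.even_mul.mp h3 with ⟨k, hk⟩ | ⟨k, hk⟩ <;> omega

/-! ### Multiplicativity and independence of the representative modulo ℛ -/

variable [hΔ : Fact (Δ < 0)] [hf : Fact (IsFundamentalDiscriminant Δ)]

/-- Forms with coprime leading coefficients can be composed compatibly with the signed
factorizations. -/
theorem exists_composite_simerka {F G : PosForm Δ} (h : IsCoprime F.a G.a) :
    ∃ H : PosForm Δ, H.toClass = F.toClass * G.toClass ∧ H.simerka = F.simerka * G.simerka := by
  obtain ⟨m, hm⟩ := (b_modEq_two F G).dvd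
  obtain ⟨α, β, hαβ⟩ := id h
  -- From αa + βa' = 1 and b' - b = 2m one gets b + 2aαm = b' - 2a'βm, a common middle coefficient.
  -- Translations change b only modulo 2a, so the signed factorizations survive.
  obtain ⟨F₁, e1, a1, b1⟩ := F.exists_shift hΔ.out (α * m)
  obtain ⟨F₂, e2, a2, b2⟩ := G.exists_shift hΔ.out (-(β * m))
  have hb : F₁.b = F₂.b := by
    rw [b1, b2]
    linear_combination (2 * m) * hαβ - hm
  have hac : F₁.a * F₁.c = F₂.a * F₂.c := by
    have h1 := F₁.disc_eq
    have h2 := F₂.disc_eq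
    rw [hb] at h1
    linarith
  rw [← a1, ← a2] at h
  obtain ⟨c, hc⟩ : F₂.a ∣ F₁.c := h.symm.dvd_of_dvd_mul_left ⟨F₂.c, hac⟩
  let H : PosForm Δ := ⟨F₁.a * F₂.a, F₁.b, c, mul_pos F₁.a_pos F₂.a_pos, by
    have h1 := F₁.disc_eq
    rw [hc] at h1
    linear_combination h1⟩
  have hH : IsDirichletComposite F₁ F₂ H := by
    refine ⟨?_, rfl, hb.symm, hc, ?_, rfl⟩
    · rw [Int.isCoprime_iff_gcd_eq_one.mp h]
      simp
    · apply mul_left_cancel₀ F₂.a_pos.ne'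
      rw [← hac]
      linear_combination F₁.a * hc
  refine ⟨H, ?_, ?_⟩
  · rw [toClass_eq.mpr e1, toClass_eq.mpr e2, FormClassGroup.toClass_mul_toClass hH]
  · rw [simerka_mul (F := F₁) (G := F₂) (H := H) rfl rfl hb.symm]
    congr 1
    · exact simerka_congr a1 (Int.modEq_iff_dvd.mpr ⟨-(α * m), by rw [b1]; ring⟩)
    · exact simerka_congr a2 (Int.modEq_iff_dvd.mpr ⟨β * m, by rw [b2]; ring⟩)

/-- After normalizing the middle coefficient, the matrix carrying the principal form to F exhibits
the value as one of the generators of ℛ, its first column being the primitive representation. -/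
theorem simerka_mem_of_toClass_eq_one {F : PosForm Δ} (h : F.toClass = 1) :
    F.simerka ∈ simerkaRelations Δ := by
  obtain ⟨G, hG, h1, h2, hs⟩ := F.exists_normalized hΔ.out
  rw [FormClassGroup.one_eq, toClass_eq] at h
  obtain ⟨x, u, y, v, ht⟩ := h.symm.trans hG
  refine Subgroup.subset_closure ⟨x, y, ⟨v, -u, by linarith [ht.1]⟩, u, v, G, ht, h1, h2, ?_⟩
  rw [hs]
  rfl

/-- Both values are compared with that of one auxiliary form K in the inverse class, whose leading
coefficient is coprime to both others so that both composites exist. -/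
theorem simerka_congr_of_equivalent {F G : PosForm Δ} (h : F.Equivalent G) :
    (F.simerka : ℚˣ ⧸ simerkaRelations Δ) = G.simerka := by
  have ha := mul_ne_zero F.a_pos.ne' G.a_pos.ne'
  obtain ⟨K, hK, hco⟩ := F.opposite.exists_coprime hΔ.out hf.out ha
  obtain ⟨h1, h2⟩ := IsCoprime.mul_left_iff.mp hco
  have key : ∀ E : PosForm Δ, E.toClass = F.toClass → IsCoprime E.a K.a →
      E.simerka * K.simerka ∈ simerkaRelations Δ := by
    intro E hE hc
    obtain ⟨H, hH, hs⟩ := exists_composite_simerka hc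
    rw [← hs]
    apply simerka_mem_of_toClass_eq_one
    rw [hH, hE, ← toClass_eq.mpr hK, ← FormClassGroup.inv_toClass, mul_inv_cancel]
  have k1 := key F rfl h1
  have k2 := key G (toClass_eq.mpr h).symm h2
  rw [QuotientGroup.eq]
  -- The value of K cancels in (š(F)š(K))⁻¹ · š(G)š(K).
  convert Subgroup.mul_mem _ (Subgroup.inv_mem _ k1) k2 using 1
  simp [mul_comm, mul_left_comm]

end PosForm

/-! ### Forms with prime leading coefficient -/

section PrimeForms

open PosForm

variable {Δ : ℤ}

/-- The two residues x, y in [0, p] have the same parity and satisfy x² ≡ y² mod 4p, as both squares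
are congruent to Δ. A square root of Δ is determined up to sign here, and the range fixes the sign.
The argument also covers p = 2. -/
theorem centeredResidue_unique {p : ℕ} (hp : p.Prime) {F G : PosForm Δ} (hF : F.a = p)
    (hG : G.a = p) (hF0 : 0 ≤ centeredResidue p F.b) (hG0 : 0 ≤ centeredResidue p G.b) :
    F.b ≡ G.b [ZMOD 2 * p] := by
  obtain ⟨-, hx, hxF⟩ := (centeredResidue_spec hp.pos F.b _).mp rfl
  obtain ⟨-, hy, hyG⟩ := (centeredResidue_spec hp.pos G.b _).mp rfl
  refine hxF.symm.trans (Int.ModEq.trans ?_ hyG)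
  generalize centeredResidue p F.b = x at *
  generalize centeredResidue p G.b = y at *
  obtain ⟨k, hk⟩ := hxF.dvd
  obtain ⟨l, hl⟩ := hyG.dvd
  have hd : (x - y) * (x + y) = 4 * p * (F.c - G.c - x * k - p * k ^ 2 + y * l + p * l ^ 2) := by
    have h1 := F.disc_eq
    have h2 := G.disc_eq
    rw [hF, show F.b = x + 2 * p * k by linarith] at h1
    rw [hG, show G.b = y + 2 * p * l by linarith] at h2
    linear_combination h1 - h2
  obtain ⟨m, hm⟩ := (b_modEq_two F G).dvd
  have hpar : ∃ t, y = x + 2 * t :=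
    ⟨m + p * k - p * l, by linear_combination hm + hk - hl⟩
  obtain ⟨t, rfl⟩ := hpar
  generalize F.c - G.c - x * k - p * k ^ 2 + (x + 2 * t) * l + p * l ^ 2 = e at hd
  have hd' : t * (x + t) = p * (-e) := by linarith
  have hp' : Prime (p : ℤ) := Nat.prime_iff_prime_int.mp hp
  have hp2 := hp.two_le
  -- With y = x + 2t, either p divides t, so x ≡ y mod 2p, or p divides x + t = (x + y)/2. The
  -- latter lies in [0, p], so it is 0 or p, and then x and y coincide at that endpoint.
  rcases hp'.dvd_or_dvd ⟨_, hd'⟩ with ⟨j, hj⟩ | ⟨j, hj⟩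
  · exact Int.modEq_iff_dvd.mpr ⟨j, by linear_combination 2 * hj⟩
  · have j0 : 0 ≤ j := by
      by_contra hn
      have : (p : ℤ) * j ≤ p * (-1) := by gcongr; omega
      omega
    have j1 : j ≤ 1 := by
      by_contra hn
      have : (p : ℤ) * 2 ≤ p * j := by gcongr; omega
      omega
    have : t = 0 := by
      obtain rfl | rfl : j = 0 ∨ j = 1 := by omega
      all_goals simp at hj; omega
    simp [this]

theorem centeredResidue_neg {p : ℕ} (hp : 0 < p) {B : ℤ} (h : centeredResidue p B < 0) :
    0 ≤ centeredResidue p (-B) := by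
  obtain ⟨h1, h2, h3⟩ := (centeredResidue_spec hp B _).mp rfl
  rw [(centeredResidue_spec hp (-B) (-centeredResidue p B)).mpr ⟨by omega, by omega, h3.neg⟩]
  omega

variable (Δ) [hΔ : Fact (Δ < 0)] [hf : Fact (IsFundamentalDiscriminant Δ)]

/-- Up to the sign attached to `p`, all forms with leading coefficient `p` have the same class. -/
theorem exists_primeClass {p : ℕ} (hp : p.Prime) : ∃ X : FormClassGroup Δ,
    ∀ F : PosForm Δ, F.a = p → F.toClass = X ^ simerkaSign p F.b := by
  suffices h : ∃ X : FormClassGroup Δ,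
      ∀ F : PosForm Δ, F.a = p → 0 ≤ centeredResidue p F.b → F.toClass = X by
    obtain ⟨X, hX⟩ := h
    refine ⟨X, fun F hF => ?_⟩
    rw [simerkaSign]
    split_ifs with h0
    · rw [zpow_one, hX F hF h0]
    · have := hX F.opposite hF (centeredResidue_neg hp.pos (not_le.mp h0))
      rw [zpow_neg_one, ← this, ← FormClassGroup.inv_toClass, inv_inv]
  by_cases h : ∃ G : PosForm Δ, G.a = p ∧ 0 ≤ centeredResidue p G.b
  · obtain ⟨G, hG, hG0⟩ := h
    refine ⟨G.toClass, fun F hF hF0 => toClass_eq.mpr ?_⟩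
    refine equivalent_of_modEq hΔ.out (hF.trans hG.symm) ?_
    rw [hG]
    exact centeredResidue_unique hp hF hG hF0 hG0
  · push Not at h
    -- No form with leading coefficient p has sign +1, so the choice of class is immaterial.
    exact ⟨1, fun F hF hF0 => absurd hF0 (not_le.mpr (h F hF))⟩

end PrimeForms

/-! ### Recovering the class from the signed factorization -/

/-- Homomorphisms out of `ℚˣ` can be prescribed on the primes. -/
theorem exists_hom_of_primes {G : Type*} [CommGroup G] (P : Nat.Primes → G) :
    ∃ ψ : ℚˣ →* G, ∀ (p : Nat.Primes) (r : ℚˣ), (r : ℚ) = (p : ℕ) → ψ r = P p := by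
  -- The homomorphism is the product of P p ^ v_p(r) over all primes, finite because v_p(r) = 0
  -- unless p divides the numerator or denominator. It sends -1 to 1.
  have hfin : ∀ r : ℚˣ, (Function.mulSupport fun p : Nat.Primes =>
      P p ^ padicValRat p (r : ℚ)).Finite := by
    intro r
    have hn : (r : ℚ).num.natAbs * (r : ℚ).den ≠ 0 :=
      mul_ne_zero (Int.natAbs_ne_zero.mpr (Rat.num_ne_zero.mpr r.ne_zero)) (r : ℚ).den_ne_zero
    refine ((Nat.primeFactors ((r : ℚ).num.natAbs * (r : ℚ).den)).finite_toSet.preimage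
      (f := fun p : Nat.Primes => (p : ℕ)) Subtype.val_injective.injOn).subset fun p hp => ?_
    refine Nat.mem_primeFactors.mpr ⟨p.2, ?_, hn⟩
    by_contra hd
    rw [p.2.dvd_mul, not_or] at hd
    apply hp
    have h1 : padicValInt p (r : ℚ).num = 0 := padicValNat.eq_zero_of_not_dvd hd.1
    have h2 : padicValNat p (r : ℚ).den = 0 := padicValNat.eq_zero_of_not_dvd hd.2
    simp [padicValRat, h1, h2]
  refine ⟨MonoidHom.mk' (fun r => ∏ᶠ p : Nat.Primes, P p ^ padicValRat p (r : ℚ)) ?_, ?_⟩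
  · intro r s
    rw [← finprod_mul_distrib (hfin r) (hfin s)]
    refine finprod_congr fun p => ?_
    have : Fact (p : ℕ).Prime := ⟨p.2⟩
    rw [Units.val_mul, padicValRat.mul r.ne_zero s.ne_zero, zpow_add]
  · intro p r hr
    have : Fact (p : ℕ).Prime := ⟨p.2⟩
    simp only [MonoidHom.mk'_apply, hr]
    rw [finprod_eq_single _ p]
    · simp [padicValRat.self p.2.one_lt]
    · intro q hq
      have : Fact (q : ℕ).Prime := ⟨q.2⟩
      have : ¬ (q : ℕ) ∣ p := fun h =>
        hq (Subtype.ext ((Nat.prime_dvd_prime_iff_eq q.2 p.2).mp h))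
      rw [padicValRat.of_nat, padicValNat.eq_zero_of_not_dvd this]
      simp

/-- The class of a form can be recovered from the signed factorization of its leading
coefficient. -/
theorem exists_hom_simerka (Δ : ℤ) [hΔ : Fact (Δ < 0)] [hf : Fact (IsFundamentalDiscriminant Δ)] :
    ∃ ψ : ℚˣ →* FormClassGroup Δ, ∀ F : PosForm Δ, ψ F.simerka = F.toClass := by
  choose P hP using fun p : Nat.Primes => exists_primeClass Δ p.2
  obtain ⟨ψ, hψ⟩ := exists_hom_of_primes P
  refine ⟨ψ, fun F => ?_⟩
  induction hn : F.a.toNat using Nat.strong_induction_on generalizing F with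
  | _ n ih =>
  have hFn : F.a = n := by rw [← hn, F.toNat_a]
  have ha := F.a_pos
  by_cases h1 : n = 1
  · have hs : F.simerka = 1 := by
      apply Units.ext
      simp only [PosForm.simerka, Units.val_mk0, Units.val_one]
      rw [hn, h1, signedFactorization_one]
    rw [hs, map_one, FormClassGroup.toClass_eq_one (by simp [hFn, h1])]
  · obtain ⟨p, hp, m, rfl⟩ := Nat.exists_prime_and_dvd h1
    have hm : 0 < m := Nat.pos_of_ne_zero (by rintro rfl; simp at hFn; omega)
    have hd := F.disc_eq
    rw [hFn] at hd
    push_cast at hd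
    -- The form (pm, b, c) is the composite of (p, b, mc) and (m, b, pc). The first is covered by
    -- the prime case, the second by induction on the leading coefficient.
    let A : PosForm Δ := ⟨p, F.b, m * F.c, by exact_mod_cast hp.pos, by linear_combination hd⟩
    let B : PosForm Δ := ⟨m, F.b, p * F.c, by exact_mod_cast hm, by linear_combination hd⟩
    have hcomp : IsDirichletComposite A B F := by
      refine ⟨?_, rfl, rfl, rfl, rfl, by simp [hFn, A, B]⟩
      -- A prime q dividing p, m and b would divide all three coefficients of (m, b, pc),
      -- contradicting primitivity. Thus p may divide m.
      by_contra hne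
      obtain ⟨q, hq, hqd⟩ := Nat.exists_prime_and_dvd hne
      have h2 : (q : ℤ) ∣ Int.gcd A.a B.a :=
        (Int.natCast_dvd_natCast.mpr hqd).trans (Int.gcd_dvd_left _ _)
      have hqp : (q : ℤ) ∣ p := h2.trans (Int.gcd_dvd_left _ _)
      exact B.primitive hf.out q hq (h2.trans (Int.gcd_dvd_right _ _))
        ((Int.natCast_dvd_natCast.mpr hqd).trans (Int.gcd_dvd_right _ _)) (hqp.mul_right _)
    have hA : ψ A.simerka = A.toClass := by
      have hr : A.simerka =
          (Units.mk0 (p : ℚ) (by exact_mod_cast hp.ne_zero)) ^ simerkaSign p F.b := by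
        apply Units.ext
        simpa [PosForm.simerka, A] using signedFactorization_prime hp F.b
      rw [hr, map_zpow, hψ ⟨p, hp⟩ _ rfl]
      exact (hP ⟨p, hp⟩ A rfl).symm
    have hB : ψ B.simerka = B.toClass :=
      ih m (lt_mul_of_one_lt_left hm hp.one_lt) B (by simp [B])
    rw [PosForm.simerka_mul hcomp.2.2.2.2.2 hcomp.2.1 hcomp.2.2.1, map_mul, hA, hB,
      FormClassGroup.toClass_mul_toClass hcomp]

/-! ### The Šimerka homomorphism and its injectivity -/

theorem mainTheorem1 (Δ : ℤ) [Fact (Δ < 0)] [Fact (IsFundamentalDiscriminant Δ)] :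
    ∃ f : FormClassGroup Δ →* ℚˣ ⧸ simerkaRelations Δ,
      (∀ (Q : PosForm Δ) (x y : ℤ) (r : ℚˣ), IsCoprime x y → Q.IsSimerkaValue x y r →
        f Q.toClass = (r : ℚˣ ⧸ simerkaRelations Δ)) ∧
      Function.Injective f := by
  have hΔ : Δ < 0 := Fact.out
  have hf : IsFundamentalDiscriminant Δ := Fact.out
  have hval : ∀ {Q : PosForm Δ} {x y : ℤ} {r : ℚˣ}, Q.IsSimerkaValue x y r →
      ∃ F : PosForm Δ, Q.Equivalent F ∧ r = F.simerka := by
    rintro Q x y r ⟨u, v, F, hF, -, -, hr⟩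
    exact ⟨F, ⟨_, _, _, _, hF⟩, Units.ext hr⟩
  obtain ⟨ψ, hψ⟩ := exists_hom_simerka Δ
  -- Each generator of ℛ is the value of a form in the principal class, and ψ sends it to that
  -- class.
  have hker : simerkaRelations Δ ≤ ψ.ker := by
    refine (Subgroup.closure_le _).mpr ?_
    rintro r ⟨x, y, -, hr⟩
    obtain ⟨F, hF, rfl⟩ := hval hr
    rw [SetLike.mem_coe, MonoidHom.mem_ker, hψ, FormClassGroup.one_eq]
    exact (PosForm.toClass_eq.mpr hF).symm
  let g : FormClassGroup Δ → ℚˣ ⧸ simerkaRelations Δ :=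
    Quotient.lift (fun Q : PosForm Δ => (Q.simerka : ℚˣ ⧸ simerkaRelations Δ))
      fun _ _ h => PosForm.simerka_congr_of_equivalent h
  have hg : ∀ Q : PosForm Δ, g Q.toClass = Q.simerka := fun _ => rfl
  refine ⟨MonoidHom.mk' g ?_, ?_, ?_⟩
  · intro X Y
    obtain ⟨F, rfl⟩ := X.exists_rep
    obtain ⟨Q, rfl⟩ := Y.exists_rep
    -- The map is already defined on classes, so Q may be replaced by a form that composes with F.
    obtain ⟨G, hQG, hco⟩ := Q.exists_coprime hΔ hf F.a_pos.ne'
    rw [PosForm.toClass_eq.mpr hQG]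
    obtain ⟨H, hH, hs⟩ := PosForm.exists_composite_simerka hco
    rw [← hH, hg, hg, hg, hs, QuotientGroup.mk_mul]
  · intro Q x y r _ hr
    obtain ⟨F, hF, rfl⟩ := hval hr
    rw [MonoidHom.mk'_apply, PosForm.toClass_eq.mpr hF, hg]
  · intro X Y h
    obtain ⟨F, rfl⟩ := X.exists_rep
    obtain ⟨G, rfl⟩ := Y.exists_rep
    simp only [MonoidHom.mk'_apply] at h
    rw [hg, hg, QuotientGroup.eq] at h
    -- Since š(F)⁻¹š(G) lies in ℛ, applying ψ gives [F]⁻¹[G] = 1.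
    have := MonoidHom.mem_ker.mp (hker h)
    rw [map_mul, map_inv, hψ, hψ, inv_mul_eq_one] at this
    exact this
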